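/- Let $A\in\mathbb{R}^{d\times d}$ have rank $d$, put $\Sigma=AA^\top$, and let $A=LQ^\top$ with $L$ lower triangular with nonnegative (hence positive) diagonal entries and $Q$ orthogonal. Let $\mathbf{l}\in\mathbb{R}^d$ and $\gamma>0$. Write $\overline\Phi(t)=\mathbb{P}(Z\ge t)$ for $Z\sim\mathsf N(0,1)$, $\phi(\cdot\,;\mu,1)$ for the density of $\mathsf N(\mu,1)$, $\mathscr C_\gamma=\{\mathbf{x}\in\mathbb{R}^d: L\mathbf{x}\ge\gamma\mathbf{l}\}$ (inequalities between vectors are componentwise), and $$\tilde l_k(\mathbf{x})=\frac{\gamma l_k-\sum_{j<k}L_{kj}x_j}{L_{kk}},\qquad \psi_\gamma(\mathbf{x};\boldsymbol\mu)=-\mathbf{x}^\top\boldsymbol\mu+\frac{\|\boldsymbol\mu\|^2}{2}+\sum_{k=1}^d\log\overline\Phi\big(\tilde l_k(\mathbf{x})-\mu_k\big).$$ For $\boldsymbol\mu\in\mathbb{R}^d$ let $\mathbb{P}_{\boldsymbol\mu}$ be the law of the random vector $\mathbf{X}$ in $\mathbb{R}^d$ with density $$g(\mathbf{x};\boldsymbol\mu)=\prod_{k=1}^d\frac{\phi(x_k;\mu_k,1)\,\mathbb{I}\{x_k\ge\tilde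 l_k(\mathbf{x})\}}{\overline\Phi(\tilde l_k(\mathbf{x})-\mu_k)}.$$ For each $\gamma>0$ let $\boldsymbol\mu^*=\boldsymbol\mu^*(\gamma)$ be the minimax tilting parameter, that is, a point that attains $\inf_{\boldsymbol\mu}\sup_{\mathbf{x}\in\mathscr C_\gamma}\psi_\gamma(\mathbf{x};\boldsymbol\mu)$. Let $\ell(\gamma)=\mathbb{P}(A\mathbf{Z}\ge\gamma\mathbf{l})$ with $\mathbf{Z}\sim\mathsf N(\mathbf{0},I_d)$. Suppose that either 1. $\mathbf{l}>\mathbf{0}$ and the minimax estimator $\hat\ell(\gamma)=\exp(\psi_\gamma(\mathbf{X};\boldsymbol\mu^*))$, $\mathbf{X}\sim\mathbb{P}_{\boldsymbol\mu^*}$, has vanishing relative error: $\limsup_{\gamma\to\infty}\mathrm{Var}_{\boldsymbol\mu^*}(\hat\ell(\gamma))/\ell(\gamma)^2=0$; or 2. $\mathbf{l}=\Sigma\mathbf{l}^*$ for some $\mathbf{l}^*>\mathbf{0}$. Let $\mathbb{P}$ be the truncated normal law of $\mathbf{Z}$ with density $f(\mathbf{z})\propto\exp(-\tfrac12\mathbf{z}^\top\mathbf{z})\,\mathbb{I}\{A\mathbf{z}\ge\gamma\mathbf{l}\}$,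 and under $\mathbb{P}_{\boldsymbol\mu^*}$ let $\mathbf{Z}=Q\mathbf{X}$ with $\mathbf{X}$ of density $g(\cdot\,;\boldsymbol\mu^*)$. Then $$\sup_{\mathscr A}\big|\mathbb{P}(\mathbf{Z}\in\mathscr A)-\mathbb{P}_{\boldsymbol\mu^*}(\mathbf{Z}\in\mathscr A)\big|\to0\qquad(\gamma\to\infty),$$ where the supremum is over all Borel sets $\mathscr A\subseteq\mathbb{R}^d$. -/

import Mathlib

open MeasureTheory ProbabilityTheory Filter Topology
open scoped Matrix ENNReal

noncomputable section

namespace MinimaxTilting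

/-- `A = L Qᵀ` with `L` lower triangular with nonnegative diagonal and `Q` orthogonal. -/
structure IsLQ {d : ℕ} (A L Q : Matrix (Fin d) (Fin d) ℝ) : Prop where
  eq_mul : A = L * Qᵀ
  lower : ∀ i j, i < j → L i j = 0
  diag_nonneg : ∀ i, 0 ≤ L i i
  orthogonal : Q ∈ Matrix.orthogonalGroup (Fin d) ℝ

/-- Law of the standard normal random vector `N(0, I_d)`. -/
def stdNormal (d : ℕ) : Measure (Fin d → ℝ) :=
  Measure.pi fun _ => gaussianReal 0 1

/-- The polyhedron `{x : M x ≥ b}` (componentwise). -/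
def polyhedron {d : ℕ} (M : Matrix (Fin d) (Fin d) ℝ) (b : Fin d → ℝ) : Set (Fin d → ℝ) :=
  {x | ∀ k, b k ≤ (M *ᵥ x) k}

/-- The probability `ℓ = P(A Z ≥ b)` for `Z ∼ N(0, I_d)`. -/
def tailProb {d : ℕ} (A : Matrix (Fin d) (Fin d) ℝ) (b : Fin d → ℝ) : ℝ≥0∞ :=
  stdNormal d (polyhedron A b)

/-- The truncated normal law, with density proportional to `φ(z; 0, I) 1{A z ≥ b}`. -/
def target {d : ℕ} (A : Matrix (Fin d) (Fin d) ℝ) (b : Fin d → ℝ) : Measure (Fin d → ℝ) :=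
  cond (stdNormal d) (polyhedron A b)

/-- Upper tail `P(Z ≥ t)` of the one-dimensional standard normal distribution. -/
def normalTail (t : ℝ) : ℝ :=
  (gaussianReal 0 1).real (Set.Ici t)

/-- The sequential lower bound `(b_k - ∑_{j < k} L_{kj} x_j) / L_{kk}`. -/
def lowerBound {d : ℕ} (L : Matrix (Fin d) (Fin d) ℝ) (b x : Fin d → ℝ) (k : Fin d) : ℝ :=
  (b k - ∑ j ∈ Finset.Iio k, L k j * x j) / L k k

/-- The logarithm `ψ(x; μ)` of the likelihood ratio (all upper bounds are `+∞`). -/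
def psi {d : ℕ} (L : Matrix (Fin d) (Fin d) ℝ) (b x μ : Fin d → ℝ) : ℝ :=
  -(x ⬝ᵥ μ) + (μ ⬝ᵥ μ) / 2 + ∑ k, Real.log (normalTail (lowerBound L b x k - μ k))

/-- The conditional density `g_k(x_k; μ_k | x_1, …, x_{k-1})`: the density of `N(μ_k, 1)`
truncated to `[lowerBound L b x k, ∞)`. -/
def condDensity {d : ℕ} (L : Matrix (Fin d) (Fin d) ℝ) (b x μ : Fin d → ℝ) (k : Fin d) : ℝ :=
  (Set.Ici (lowerBound L b x k)).indicator (gaussianPDFReal (μ k) 1) (x k) /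
    normalTail (lowerBound L b x k - μ k)

/-- The measure `P_μ` with density `g(x; μ) = ∏ₖ g_k(x_k; μ_k | x_1, …, x_{k-1})`. -/
def tilted {d : ℕ} (L : Matrix (Fin d) (Fin d) ℝ) (b μ : Fin d → ℝ) : Measure (Fin d → ℝ) :=
  (volume : Measure (Fin d → ℝ)).withDensity fun x =>
    ENNReal.ofReal (∏ k, condDensity L b x μ k)

/-- Law under `P_μ` of `Z = Q X`, that is, `P_μ` in the coordinates of the target. -/
def instrumental {d : ℕ} (L Q : Matrix (Fin d) (Fin d) ℝ) (b μ : Fin d → ℝ) :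
    Measure (Fin d → ℝ) :=
  (tilted L b μ).map fun x => Q *ᵥ x

/-- `μ` attains `inf_μ sup_{x : L x ≥ b} ψ(x; μ)`. The supremum may be `+∞` for some `μ`, so it is
taken in the extended reals. -/
def IsMinimaxTilt {d : ℕ} (L : Matrix (Fin d) (Fin d) ℝ) (b μ : Fin d → ℝ) : Prop :=
  ∀ ν : Fin d → ℝ,
    (⨆ x ∈ polyhedron L b, ((psi L b x μ : ℝ) : EReal)) ≤
      ⨆ x ∈ polyhedron L b, ((psi L b x ν : ℝ) : EReal)

/-- The estimator `exp(ψ(X; μ γ))`, `X ∼ P_{μ γ}`, of `ℓ(γ) = P(A Z ≥ γ l)` has vanishing relative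
error: `limsup_{γ → ∞} Var(exp(ψ(X; μ γ))) / ℓ(γ)² = 0`. -/
def HasVanishingRelativeError {d : ℕ} (A L : Matrix (Fin d) (Fin d) ℝ) (l : Fin d → ℝ)
    (μ : ℝ → Fin d → ℝ) : Prop :=
  limsup (fun γ : ℝ =>
    evariance (fun x => Real.exp (psi L (γ • l) x (μ γ))) (tilted L (γ • l) (μ γ)) /
      tailProb A (γ • l) ^ 2) atTop = 0

/-- Total variation distance `sup_S |P(S) - P'(S)|` over measurable `S`, for finite measures. -/
def tvDist {d : ℕ} (P P' : Measure (Fin d → ℝ)) : ℝ :=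
  ⨆ S : {S : Set (Fin d → ℝ) // MeasurableSet S}, |P.real S - P'.real S|

end MinimaxTilting

end

/-! ### Sequential integration and the Gaussian law. -/

namespace MinimaxTilting

/-! The Gaussian law is rotation invariant and `A Q = L`, so both laws are images under `Q` of laws
in the coordinates of `L`. There the target has density `V / ℓ` with respect to the tilted law,
where `V = exp ψ` has mean `ℓ` (`tilted_withDensity_exp_psi`, `target_real_eq`). Two general
estimates of total variation then apply.

In the first case the distance is at most `E|V - ℓ| / ℓ`, hence at most the relative standard
deviation (`abs_measureReal_sub_le_sqrt_variance`).

In the second, an almost sure bound `V ≤ B` gives distance at most `B / ℓ - 1`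
(`abs_measureReal_sub_le_of_ae_le`). The minimax tilt need not be located: its supremum of `ψ` is at
most that of the explicit `dualTilt`, where an exponential tail bound makes all terms in `x` cancel
(`psi_dualTilt_le`). An exact change of variables shows `ℓ = B * tailRatio` for this same `B`
(`tailProb_toReal_eq`), and the ratio tends to 1 by dominated convergence. -/

/-- A product of factors, the `k`-th depending only on the coordinates up to `k` and having
integral `c k` in its own coordinate, has integral `∏ c k`. -/
theorem lintegral_prod_sequential {n : ℕ} (f : Fin n → (Fin n → ℝ) → ℝ≥0∞) (c : Fin n → ℝ≥0∞)
    (hf : ∀ k, Measurable (f k))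
    (hdep : ∀ k x y, (∀ j ≤ k, x j = y j) → f k x = f k y)
    (hint : ∀ k x, ∫⁻ t, f k (Function.update x k t) = c k) :
    ∫⁻ x, ∏ k, f k x = ∏ k, c k := by
  induction n with
  | zero => simp [volume_pi]
  | succ n ih =>
    have hmp := (volume_preserving_piFinSuccAbove (fun _ : Fin (n + 1) => ℝ) (Fin.last n)).symm
    have hmeas : Measurable fun x => ∏ k, f k x := by fun_prop
    have hsnoc : Measurable fun y : Fin n → ℝ => (Fin.snoc y 0 : Fin (n + 1) → ℝ) := by
      refine measurable_pi_lambda _ fun i => ?_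
      refine Fin.lastCases ?_ (fun j => ?_) i
      · simp
      · simpa using measurable_pi_apply j
    rw [← hmp.lintegral_comp hmeas, Measure.volume_eq_prod,
      lintegral_prod_symm' (fun p => ∏ k, f k ((MeasurableEquiv.piFinSuccAbove
        (fun _ : Fin (n + 1) => ℝ) (Fin.last n)).symm p))
        (hmeas.comp (MeasurableEquiv.measurable _))]
    -- All factors but the last ignore the last coordinate, so the value 0 put there is arbitrary.
    have key : ∀ (y : Fin n → ℝ) (t : ℝ),
        ∏ k, f k ((MeasurableEquiv.piFinSuccAbove (fun _ : Fin (n + 1) => ℝ) (Fin.last n)).symm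
          (t, y)) = (∏ k : Fin n, f k.castSucc (Fin.snoc y 0)) *
            f (Fin.last n) (Function.update (Fin.snoc y 0) (Fin.last n) t) := by
      intro y t
      have : (MeasurableEquiv.piFinSuccAbove (fun _ : Fin (n + 1) => ℝ) (Fin.last n)).symm (t, y)
          = (Fin.snoc y t : Fin (n + 1) → ℝ) := by
        simp [MeasurableEquiv.piFinSuccAbove_symm_apply, Fin.insertNthEquiv]
      rw [this, Fin.prod_univ_castSucc, Fin.update_snoc_last]
      congr 1
      refine Finset.prod_congr rfl fun k _ => hdep _ _ _ fun j hj => ?_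
      obtain ⟨i, rfl⟩ := Fin.exists_castSucc_eq.2
        (ne_of_lt (lt_of_le_of_lt hj (Fin.castSucc_lt_last k)))
      simp
    simp_rw [key]
    have inner : ∀ y : Fin n → ℝ, ∫⁻ t, (∏ k : Fin n, f k.castSucc (Fin.snoc y 0)) *
        f (Fin.last n) (Function.update (Fin.snoc y 0) (Fin.last n) t) =
        (∏ k : Fin n, f k.castSucc (Fin.snoc y 0)) * c (Fin.last n) := by
      intro y
      have hm : Measurable fun t => f (Fin.last n)
          (Function.update (Fin.snoc y 0 : Fin (n + 1) → ℝ) (Fin.last n) t) :=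
        (hf _).comp (measurable_update _)
      rw [lintegral_const_mul _ hm, hint]
    simp_rw [inner]
    have hm : Measurable fun y : Fin n → ℝ => ∏ k : Fin n, f k.castSucc (Fin.snoc y 0) :=
      Finset.measurable_prod _ fun k _ => (hf _).comp hsnoc
    rw [lintegral_mul_const _ hm, ih (fun k y => f k.castSucc (Fin.snoc y 0)) (fun k => c k.castSucc)
        (fun k => (hf _).comp hsnoc), Fin.prod_univ_castSucc]
    · intro k x y hxy
      refine hdep _ _ _ fun j hj => ?_
      obtain ⟨i, rfl⟩ := Fin.exists_castSucc_eq.2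
        (ne_of_lt (lt_of_le_of_lt hj (Fin.castSucc_lt_last k)))
      simpa using hxy i (by simpa using hj)
    · intro k x
      simp_rw [Fin.snoc_update]
      exact hint _ _

/-- The density of the standard normal random vector. -/
noncomputable def stdDensity {d : ℕ} (x : Fin d → ℝ) : ℝ :=
  ∏ k, gaussianPDFReal 0 1 (x k)

theorem stdDensity_pos {d : ℕ} (x : Fin d → ℝ) : 0 < stdDensity x :=
  Finset.prod_pos fun _ _ => gaussianPDFReal_pos _ _ _ one_ne_zero

theorem measurable_stdDensity {d : ℕ} : Measurable (stdDensity (d := d)) :=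
  Finset.measurable_prod _ fun k _ =>
    (measurable_gaussianPDFReal _ _).comp (measurable_pi_apply k)

theorem stdDensity_eq {d : ℕ} (x : Fin d → ℝ) :
    stdDensity x = (√(2 * Real.pi))⁻¹ ^ d * Real.exp (-(x ⬝ᵥ x) / 2) := by
  simp only [stdDensity, gaussianPDFReal, Finset.prod_mul_distrib, ← Real.exp_sum, dotProduct]
  simp [Finset.sum_div, pow_two, neg_div]

theorem stdNormal_eq_withDensity (d : ℕ) :
    stdNormal d = volume.withDensity fun x => ENNReal.ofReal (stdDensity x) := by
  refine Measure.pi_eq fun s hs => ?_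
  rw [withDensity_apply _ (.univ_pi hs), ← lintegral_indicator (.univ_pi hs)]
  have : (fun x : Fin d → ℝ => (Set.univ.pi s).indicator
      (fun x => ENNReal.ofReal (stdDensity x)) x) =
      fun x => ∏ k, (s k).indicator (gaussianPDF 0 1) (x k) := by
    ext x
    by_cases hx : x ∈ Set.univ.pi s
    · rw [Set.indicator_of_mem hx, stdDensity,
        ENNReal.ofReal_prod_of_nonneg fun _ _ => gaussianPDFReal_nonneg _ _ _]
      exact Finset.prod_congr rfl fun k _ => by
        rw [Set.indicator_of_mem (hx k (Set.mem_univ k)), gaussianPDF]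
    · rw [Set.indicator_of_notMem hx]
      obtain ⟨k, hk⟩ : ∃ k, x k ∉ s k := by simpa using hx
      exact (Finset.prod_eq_zero (Finset.mem_univ k) (Set.indicator_of_notMem hk _)).symm
  rw [this]
  refine lintegral_prod_sequential _ _
    (fun k => ((measurable_gaussianPDF 0 1).indicator (hs k)).comp (measurable_pi_apply k))
    (fun k x y h => by rw [h k le_rfl]) fun k x => ?_
  simp only [Function.update_self]
  rw [lintegral_indicator (hs k), gaussianReal_apply _ one_ne_zero]

instance (d : ℕ) : IsProbabilityMeasure (stdNormal d) := by
  unfold stdNormal; infer_instance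

theorem normalTail_eq (t : ℝ) :
    normalTail t = ∫ x in Set.Ici t, gaussianPDFReal 0 1 x := by
  rw [normalTail, measureReal_def, gaussianReal_apply_eq_integral _ one_ne_zero,
    ENNReal.toReal_ofReal (integral_nonneg fun _ => gaussianPDFReal_nonneg _ _ _)]

theorem normalTail_pos (t : ℝ) : 0 < normalTail t := by
  rw [normalTail_eq, setIntegral_pos_iff_support_of_nonneg_ae
    (ae_of_all _ fun _ => gaussianPDFReal_nonneg _ _ _)
    (integrable_gaussianPDFReal 0 1).integrableOn]
  have : Function.support (gaussianPDFReal 0 1) = Set.univ := by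
    ext x; simp [(gaussianPDFReal_pos 0 1 x one_ne_zero).ne']
  simp [this]

/-- The tangent line inequality `-x² / 2 ≤ w² / 2 - w x`, integrated over `[u, ∞)`. No sign of `u`
is needed. -/
theorem normalTail_le {w : ℝ} (hw : 0 < w) (u : ℝ) :
    normalTail u ≤ (√(2 * Real.pi) * w)⁻¹ * Real.exp (w ^ 2 / 2 - w * u) := by
  have hi : IntegrableOn (fun x => Real.exp (-w * x)) (Set.Ioi u) :=
    integrableOn_exp_mul_Ioi (by linarith) u
  have hpi : 0 < √(2 * Real.pi) := by positivity
  rw [normalTail_eq, integral_Ici_eq_integral_Ioi]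
  calc ∫ x in Set.Ioi u, gaussianPDFReal 0 1 x
      ≤ ∫ x in Set.Ioi u, (√(2 * Real.pi))⁻¹ * Real.exp (w ^ 2 / 2) * Real.exp (-w * x) := by
        refine integral_mono (integrable_gaussianPDFReal 0 1).integrableOn (hi.const_mul _)
          fun x => ?_
        simp only [gaussianPDFReal, NNReal.coe_one, mul_one, sub_zero, mul_assoc]
        rw [← Real.exp_add]
        gcongr
        nlinarith [sq_nonneg (x - w)]
    _ = _ := by
        rw [integral_const_mul, integral_exp_mul_Ioi (by linarith), sub_eq_add_neg, Real.exp_add]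
        have : -w * u = -(w * u) := by ring
        rw [this]
        field_simp

end MinimaxTilting

/-! ### The tilted law and its likelihood ratio. -/

namespace MinimaxTilting

variable {d : ℕ} {L : Matrix (Fin d) (Fin d) ℝ} {b : Fin d → ℝ}

theorem measurable_normalTail : Measurable normalTail := by
  have : Antitone normalTail := fun s t hst => measureReal_mono (Set.Ici_subset_Ici.2 hst)
  exact this.measurable

theorem measurable_lowerBound (k : Fin d) : Measurable fun x => lowerBound L b x k := by
  unfold lowerBound
  fun_prop

theorem measurable_psi (μ : Fin d → ℝ) : Measurable fun x => psi L b x μ := by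
  have h : ∀ k, Measurable fun x => normalTail (lowerBound L b x k - μ k) := fun k =>
    measurable_normalTail.comp ((measurable_lowerBound k).sub_const _)
  unfold psi dotProduct
  fun_prop

theorem lowerBound_congr {x y : Fin d → ℝ} {k : Fin d} (h : ∀ j < k, x j = y j) :
    lowerBound L b x k = lowerBound L b y k := by
  unfold lowerBound
  rw [Finset.sum_congr rfl fun j hj => by rw [h j (Finset.mem_Iio.1 hj)]]

theorem condDensity_eq_indicator (μ : Fin d → ℝ) (k : Fin d) (x : Fin d → ℝ) :
    condDensity L b x μ k = {x : Fin d → ℝ | lowerBound L b x k ≤ x k}.indicator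
      (fun x => gaussianPDFReal (μ k) 1 (x k)) x / normalTail (lowerBound L b x k - μ k) := by
  simp [condDensity, Set.indicator_apply]

theorem measurable_condDensity (μ : Fin d → ℝ) (k : Fin d) :
    Measurable fun x => condDensity L b x μ k := by
  simp_rw [condDensity_eq_indicator]
  refine Measurable.div (Measurable.indicator ?_ ?_) ?_
  · exact (measurable_gaussianPDFReal _ _).comp (measurable_pi_apply k)
  · exact measurableSet_le (measurable_lowerBound k) (measurable_pi_apply k)
  · exact measurable_normalTail.comp ((measurable_lowerBound k).sub_const _)

theorem condDensity_nonneg (x μ : Fin d → ℝ) (k : Fin d) : 0 ≤ condDensity L b x μ k :=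
  div_nonneg (Set.indicator_nonneg (fun _ _ => gaussianPDFReal_nonneg _ _ _) _)
    (normalTail_pos _).le

theorem gaussianReal_Ici (m t : ℝ) :
    gaussianReal m 1 (Set.Ici t) = ENNReal.ofReal (normalTail (t - m)) := by
  have h := gaussianReal_map_add_const (μ := 0) (v := 1) m
  rw [zero_add] at h
  rw [← h, Measure.map_apply (by fun_prop) measurableSet_Ici, normalTail, ofReal_measureReal]
  congr 1
  ext x
  simp

/-- The truncation point involves only earlier coordinates, so it stays fixed while coordinate `k`
is integrated. This is the input that `lintegral_prod_sequential` needs to give the tilted law mass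
one. -/
theorem lintegral_condDensity (μ : Fin d → ℝ) (k : Fin d) (x : Fin d → ℝ) :
    ∫⁻ t, ENNReal.ofReal (condDensity L b (Function.update x k t) μ k) = 1 := by
  have hlb : ∀ t, lowerBound L b (Function.update x k t) k = lowerBound L b x k := fun t =>
    lowerBound_congr fun j hj => Function.update_of_ne hj.ne _ _
  have hpos := normalTail_pos (lowerBound L b x k - μ k)
  have : ∀ t, ENNReal.ofReal (condDensity L b (Function.update x k t) μ k) =
      (Set.Ici (lowerBound L b x k)).indicator (gaussianPDF (μ k) 1) t *
        (ENNReal.ofReal (normalTail (lowerBound L b x k - μ k)))⁻¹ := by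
    intro t
    rw [condDensity, hlb, Function.update_self, ENNReal.ofReal_div_of_pos hpos, div_eq_mul_inv]
    congr 1
    by_cases h : t ∈ Set.Ici (lowerBound L b x k)
    · simp only [Set.indicator_of_mem h, gaussianPDF]
    · simp only [Set.indicator_of_notMem h, ENNReal.ofReal_zero]
  simp_rw [this]
  rw [lintegral_mul_const _ ((measurable_gaussianPDF _ _).indicator measurableSet_Ici),
    lintegral_indicator measurableSet_Ici, ← gaussianReal_apply _ one_ne_zero, gaussianReal_Ici]
  exact ENNReal.mul_inv_cancel (by simpa using hpos) ENNReal.ofReal_ne_top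

instance isProbabilityMeasure_tilted (μ : Fin d → ℝ) :
    IsProbabilityMeasure (tilted L b μ) where
  measure_univ := by
    rw [tilted, withDensity_apply _ .univ, Measure.restrict_univ]
    simp_rw [ENNReal.ofReal_prod_of_nonneg fun k _ => condDensity_nonneg _ μ k]
    rw [lintegral_prod_sequential _ (fun _ => 1)
      (fun k => (measurable_condDensity μ k).ennreal_ofReal) _ (lintegral_condDensity μ)]
    · simp
    · intro k x y h
      simp only [condDensity]
      rw [h k le_rfl, lowerBound_congr fun j hj => h j hj.le]

/-- Row `k` of `L x` for lower triangular `L`. -/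
theorem mulVec_eq_sum_Iio (hL : ∀ i j, i < j → L i j = 0) (x : Fin d → ℝ) (k : Fin d) :
    (L *ᵥ x) k = ∑ j ∈ Finset.Iio k, L k j * x j + L k k * x k := by
  have : ∑ j ∈ Finset.Iic k, L k j * x j = (L *ᵥ x) k :=
    Finset.sum_subset (Finset.subset_univ _) fun j _ hj => by
      rw [hL k j (by simpa using hj), zero_mul]
  rw [← this, ← Finset.Iio_insert, Finset.sum_insert (by simp), add_comm]

theorem mem_polyhedron_iff (hL : ∀ i j, i < j → L i j = 0) (hpos : ∀ k, 0 < L k k)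
    (x : Fin d → ℝ) : x ∈ polyhedron L b ↔ ∀ k, lowerBound L b x k ≤ x k := by
  refine forall_congr' fun k => ?_
  rw [mulVec_eq_sum_Iio hL, lowerBound, div_le_iff₀ (hpos k), sub_le_iff_le_add', mul_comm (x k)]

theorem measurableSet_polyhedron (M : Matrix (Fin d) (Fin d) ℝ) :
    MeasurableSet (polyhedron M b) := by
  have : polyhedron M b = ⋂ k, {x | b k ≤ (M *ᵥ x) k} := by ext; simp [polyhedron]
  rw [this]
  refine .iInter fun k => measurableSet_le measurable_const ?_
  unfold Matrix.mulVec dotProduct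
  fun_prop

/-- The likelihood ratio of the untilted density with respect to the tilted one is `exp ψ`. -/
theorem prod_condDensity_mul_exp_psi (hL : ∀ i j, i < j → L i j = 0) (hpos : ∀ k, 0 < L k k)
    (x μ : Fin d → ℝ) :
    (∏ k, condDensity L b x μ k) * Real.exp (psi L b x μ) =
      (polyhedron L b).indicator stdDensity x := by
  by_cases hx : x ∈ polyhedron L b
  · rw [Set.indicator_of_mem hx]
    have h := (mem_polyhedron_iff hL hpos x).1 hx
    have hpsi : Real.exp (psi L b x μ) = ∏ k, (Real.exp (-(x k * μ k) + μ k * μ k / 2) *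
        normalTail (lowerBound L b x k - μ k)) := by
      simp only [psi, dotProduct]
      rw [← Finset.sum_neg_distrib, Finset.sum_div, ← Finset.sum_add_distrib, Real.exp_add,
        Real.exp_sum, Real.exp_sum, ← Finset.prod_mul_distrib]
      exact Finset.prod_congr rfl fun k _ => by rw [Real.exp_log (normalTail_pos _)]
    rw [hpsi, ← Finset.prod_mul_distrib, stdDensity]
    refine Finset.prod_congr rfl fun k _ => ?_
    rw [condDensity, Set.indicator_of_mem (Set.mem_Ici.2 (h k))]
    have := (normalTail_pos (lowerBound L b x k - μ k)).ne'
    field_simp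
    simp only [gaussianPDFReal, mul_assoc, ← Real.exp_add]
    congr 2
    simp
    ring
  · rw [Set.indicator_of_notMem hx]
    obtain ⟨k, hk⟩ : ∃ k, ¬ lowerBound L b x k ≤ x k := by
      simpa using mt (mem_polyhedron_iff hL hpos x).2 hx
    rw [Finset.prod_eq_zero (Finset.mem_univ k), zero_mul]
    rw [condDensity, Set.indicator_of_notMem (by simpa using hk), zero_div]

theorem tilted_withDensity_exp_psi (hL : ∀ i j, i < j → L i j = 0) (hpos : ∀ k, 0 < L k k)
    (μ : Fin d → ℝ) :
    (tilted L b μ).withDensity (fun x => ENNReal.ofReal (Real.exp (psi L b x μ))) =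
      (stdNormal d).restrict (polyhedron L b) := by
  have hm : Measurable fun x => ENNReal.ofReal (∏ k, condDensity L b x μ k) :=
    (Finset.measurable_prod _ fun k _ => measurable_condDensity μ k).ennreal_ofReal
  rw [tilted, ← withDensity_mul _ hm (measurable_psi μ).exp.ennreal_ofReal,
    stdNormal_eq_withDensity, restrict_withDensity (measurableSet_polyhedron L),
    ← withDensity_indicator (measurableSet_polyhedron L)]
  congr 1
  ext x
  rw [Pi.mul_apply, ← ENNReal.ofReal_mul (Finset.prod_nonneg fun k _ => condDensity_nonneg x μ k),
    prod_condDensity_mul_exp_psi hL hpos]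
  by_cases hx : x ∈ polyhedron L b
  · simp only [Set.indicator_of_mem hx]
  · simp only [Set.indicator_of_notMem hx, ENNReal.ofReal_zero]

/-- Needed because the minimax property controls `ψ` only on the polyhedron. -/
theorem ae_mem_polyhedron (hL : ∀ i j, i < j → L i j = 0) (hpos : ∀ k, 0 < L k k)
    (μ : Fin d → ℝ) : ∀ᵐ x ∂tilted L b μ, x ∈ polyhedron L b := by
  have hm : Measurable fun x => ENNReal.ofReal (∏ k, condDensity L b x μ k) :=
    (Finset.measurable_prod _ fun k _ => measurable_condDensity μ k).ennreal_ofReal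
  rw [tilted, ae_withDensity_iff hm]
  refine ae_of_all _ fun x hx => ?_
  by_contra hmem
  have h := prod_condDensity_mul_exp_psi hL hpos x μ (b := b)
  rw [Set.indicator_of_notMem hmem, mul_eq_zero, or_iff_left (Real.exp_ne_zero _)] at h
  exact hx (by rw [h, ENNReal.ofReal_zero])

end MinimaxTilting

/-! ### Total variation estimates from a likelihood ratio. -/

namespace MinimaxTilting

section TotalVariation

variable {Ω : Type*} [MeasurableSpace Ω] {P P' : Measure Ω} [IsProbabilityMeasure P]
  [IsProbabilityMeasure P'] {V : Ω → ℝ} {c : ℝ}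

/-- Domination `P ≤ (B / c) P'` bounds the difference from above on every set; passing to the
complement bounds it from below. -/
theorem abs_measureReal_sub_le_of_ae_le (hV : Integrable V P') (hc : 0 < c)
    (hP : ∀ S, MeasurableSet S → P.real S = (∫ x in S, V x ∂P') / c) {B : ℝ}
    (hB : ∀ᵐ x ∂P', V x ≤ B) {S : Set Ω} (hS : MeasurableSet S) :
    |P.real S - P'.real S| ≤ B / c - 1 := by
  have key : ∀ S, MeasurableSet S → P.real S ≤ B / c * P'.real S := by
    intro S hS
    rw [hP S hS, div_mul_eq_mul_div]
    gcongr
    calc ∫ x in S, V x ∂P' ≤ ∫ _ in S, B ∂P' :=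
          integral_mono_ae hV.integrableOn (integrable_const _) (ae_restrict_of_ae hB)
      _ = B * P'.real S := by simp [mul_comm]
  have h1 : 1 ≤ B / c := by simpa using key Set.univ .univ
  have upper : ∀ S, MeasurableSet S → P.real S - P'.real S ≤ B / c - 1 := by
    intro S hS
    have := key S hS
    have hle : P'.real S ≤ 1 := measureReal_le_one
    nlinarith
  have hcompl := upper Sᶜ hS.compl
  rw [probReal_compl_eq_one_sub hS, probReal_compl_eq_one_sub hS] at hcompl
  exact abs_le.2 ⟨by linarith, upper S hS⟩

theorem abs_measureReal_sub_le_sqrt_variance (hV : MemLp V 2 P') (hc : 0 < c)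
    (hP : ∀ S, MeasurableSet S → P.real S = (∫ x in S, V x ∂P') / c)
    {S : Set Ω} (hS : MeasurableSet S) :
    |P.real S - P'.real S| ≤ √(Var[V; P'] / c ^ 2) := by
  have hint : Integrable V P' := hV.integrable one_le_two
  have hmean : ∫ x, V x ∂P' = c := by
    have := hP Set.univ .univ
    rw [probReal_univ, setIntegral_univ, eq_div_iff hc.ne', one_mul] at this
    exact this.symm
  have hdev : MemLp (fun x => |V x - c|) 2 P' := (hV.sub (memLp_const c)).abs
  -- Cauchy–Schwarz, in the form that the variance of `|V - c|` is nonnegative.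
  have hsq : (∫ x, |V x - c| ∂P') ^ 2 ≤ Var[V; P'] := by
    have h := variance_nonneg (fun x => |V x - c|) P'
    rw [variance_eq_sub hdev] at h
    rw [variance_eq_integral hV.aemeasurable, hmean]
    simpa using h
  have heq : P.real S - P'.real S = (∫ x in S, (V x - c) ∂P') / c := by
    rw [integral_sub hint.integrableOn (integrable_const _), hP S hS]
    simp only [integral_const, measureReal_restrict_apply_univ, smul_eq_mul]
    field_simp
  rw [heq, abs_div, abs_of_pos hc, Real.sqrt_div' _ (sq_nonneg c), Real.sqrt_sq hc.le]
  gcongr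
  calc |∫ x in S, (V x - c) ∂P'| ≤ ∫ x in S, |V x - c| ∂P' := abs_integral_le_integral_abs
    _ ≤ ∫ x, |V x - c| ∂P' :=
        setIntegral_le_integral (hdev.integrable one_le_two) (ae_of_all _ fun _ => abs_nonneg _)
    _ ≤ √(Var[V; P']) := Real.le_sqrt_of_sq_le hsq

end TotalVariation

/-! ### Rotation to the lower triangular case. -/

variable {d : ℕ} {L : Matrix (Fin d) (Fin d) ℝ} {b : Fin d → ℝ}

theorem tvDist_nonneg (P P' : Measure (Fin d → ℝ)) : 0 ≤ tvDist P P' :=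
  Real.iSup_nonneg fun _ => abs_nonneg _

theorem tvDist_le {P P' : Measure (Fin d → ℝ)} {r : ℝ}
    (h : ∀ S, MeasurableSet S → |P.real S - P'.real S| ≤ r) : tvDist P P' ≤ r :=
  haveI : Nonempty {S : Set (Fin d → ℝ) // MeasurableSet S} := ⟨⟨∅, .empty⟩⟩
  ciSup_le fun S => h S S.2

theorem tvDist_map_le {P P' : Measure (Fin d → ℝ)} {r : ℝ} {f : (Fin d → ℝ) → Fin d → ℝ}
    (hf : Measurable f) (h : ∀ S, MeasurableSet S → |P.real S - P'.real S| ≤ r) :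
    tvDist (P.map f) (P'.map f) ≤ r :=
  tvDist_le fun S hS => by
    rw [map_measureReal_apply hf hS, map_measureReal_apply hf hS]
    exact h _ (hf hS)

theorem measurable_mulVec (M : Matrix (Fin d) (Fin d) ℝ) : Measurable fun x => M *ᵥ x := by
  unfold Matrix.mulVec dotProduct
  fun_prop

theorem volume_eq_smul_map_mulVec {M : Matrix (Fin d) (Fin d) ℝ} (hM : M.det ≠ 0) :
    (volume : Measure (Fin d → ℝ)) =
      ENNReal.ofReal |M.det| • volume.map fun x => M *ᵥ x := by
  have h := Real.map_matrix_volume_pi_eq_smul_volume_pi hM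
  have hM' : ⇑(Matrix.toLin' M) = fun x => M *ᵥ x := by ext; simp
  rw [hM'] at h
  rw [h, smul_smul, ← ENNReal.ofReal_mul (abs_nonneg _), ← abs_mul, mul_inv_cancel₀ hM]
  simp

/-- Lebesgue measure is preserved since `|det Q| = 1`, and the density depends only on `x ⬝ᵥ x`. -/
theorem stdNormal_map_orthogonal {Q : Matrix (Fin d) (Fin d) ℝ}
    (hQ : Q ∈ Matrix.orthogonalGroup (Fin d) ℝ) :
    (stdNormal d).map (fun x => Q *ᵥ x) = stdNormal d := by
  have hQQ : Qᵀ * Q = 1 := (Matrix.mem_orthogonalGroup_iff' (Fin d) ℝ).1 hQ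
  have hdet : |Q.det| = 1 := by
    have := congrArg Matrix.det hQQ
    rw [Matrix.det_mul, Matrix.det_transpose, Matrix.det_one, ← abs_mul_abs_self] at this
    nlinarith [abs_nonneg Q.det]
  have hvol : MeasurePreserving (fun x => Q *ᵥ x) (volume : Measure (Fin d → ℝ)) volume := by
    refine ⟨measurable_mulVec Q, ?_⟩
    have := volume_eq_smul_map_mulVec (M := Q) (by intro h; simp [h] at hdet)
    rw [hdet, ENNReal.ofReal_one, one_smul] at this
    exact this.symm
  have hden : ∀ x, stdDensity (Q *ᵥ x) = stdDensity x := fun x => by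
    rw [stdDensity_eq, stdDensity_eq, Matrix.dotProduct_mulVec, Matrix.vecMul_mulVec, hQQ,
      Matrix.vecMul_one]
  ext S hS
  rw [Measure.map_apply (measurable_mulVec Q) hS, stdNormal_eq_withDensity,
    withDensity_apply _ hS, withDensity_apply _ (measurable_mulVec Q hS),
    ← hvol.setLIntegral_comp_preimage hS measurable_stdDensity.ennreal_ofReal]
  simp_rw [hden]

theorem IsLQ.mulVec {A L Q : Matrix (Fin d) (Fin d) ℝ} (h : IsLQ A L Q) (x : Fin d → ℝ) :
    A *ᵥ (Q *ᵥ x) = L *ᵥ x := by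
  rw [h.eq_mul, Matrix.mulVec_mulVec, Matrix.mul_assoc,
    (Matrix.mem_orthogonalGroup_iff' (Fin d) ℝ).1 h.orthogonal, Matrix.mul_one]

theorem IsLQ.preimage_polyhedron {A L Q : Matrix (Fin d) (Fin d) ℝ} (h : IsLQ A L Q) :
    (fun x => Q *ᵥ x) ⁻¹' polyhedron A b = polyhedron L b := by
  ext x
  simp only [polyhedron, Set.mem_preimage, Set.mem_ofPred_eq, h.mulVec]

theorem IsLQ.tailProb_eq {A L Q : Matrix (Fin d) (Fin d) ℝ} (h : IsLQ A L Q) :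
    tailProb A b = tailProb L b := by
  rw [tailProb, ← stdNormal_map_orthogonal h.orthogonal,
    Measure.map_apply (measurable_mulVec Q) (measurableSet_polyhedron A), h.preimage_polyhedron,
    tailProb]

theorem IsLQ.target_eq_map {A L Q : Matrix (Fin d) (Fin d) ℝ} (h : IsLQ A L Q) :
    target A b = (target L b).map fun x => Q *ᵥ x := by
  ext S hS
  rw [Measure.map_apply (measurable_mulVec Q) hS, target, target,
    cond_apply (measurableSet_polyhedron A), cond_apply (measurableSet_polyhedron L)]
  have := h.tailProb_eq (b := b)
  simp only [tailProb] at this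
  rw [this]
  congr 1
  rw [← stdNormal_map_orthogonal h.orthogonal, Measure.map_apply (measurable_mulVec Q)
    ((measurableSet_polyhedron A).inter hS), Set.preimage_inter, h.preimage_polyhedron,
    stdNormal_map_orthogonal h.orthogonal]

theorem IsLQ.det_ne_zero {A L Q : Matrix (Fin d) (Fin d) ℝ} (h : IsLQ A L Q)
    (hA : A.rank = d) : L.det ≠ 0 := by
  have hrank : L.rank = Fintype.card (Fin d) := by
    refine le_antisymm (Matrix.rank_le_card_height L) ?_
    have := Matrix.rank_mul_le_left L Qᵀ
    rw [← h.eq_mul, hA] at this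
    simpa using this
  have hli := (Matrix.rank_eq_finrank_span_row L).symm.trans hrank
  have : LinearIndependent ℝ L.row := linearIndependent_iff_card_eq_finrank_span.2 hli.symm
  exact ((Matrix.isUnit_iff_isUnit_det L).1
    (Matrix.linearIndependent_rows_iff_isUnit.1 this)).ne_zero

theorem IsLQ.det_eq_prod {A L Q : Matrix (Fin d) (Fin d) ℝ} (h : IsLQ A L Q) :
    L.det = ∏ k, L k k :=
  Matrix.det_of_isLowerTriangular L fun i j hij => h.lower i j hij

theorem IsLQ.diag_pos {A L Q : Matrix (Fin d) (Fin d) ℝ} (h : IsLQ A L Q)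
    (hA : A.rank = d) (k : Fin d) : 0 < L k k := by
  refine lt_of_le_of_ne (h.diag_nonneg k) fun hk => h.det_ne_zero hA ?_
  rw [h.det_eq_prod]
  exact Finset.prod_eq_zero (Finset.mem_univ k) hk.symm

theorem integrable_exp_psi (hL : ∀ i j, i < j → L i j = 0) (hpos : ∀ k, 0 < L k k)
    (μ : Fin d → ℝ) : Integrable (fun x => Real.exp (psi L b x μ)) (tilted L b μ) := by
  refine ⟨(measurable_psi μ).exp.aestronglyMeasurable, ?_⟩
  rw [hasFiniteIntegral_iff_ofReal (ae_of_all _ fun _ => (Real.exp_pos _).le),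
    ← setLIntegral_univ, ← withDensity_apply _ .univ, tilted_withDensity_exp_psi hL hpos]
  exact measure_lt_top _ _

theorem target_real_eq (hL : ∀ i j, i < j → L i j = 0) (hpos : ∀ k, 0 < L k k)
    (μ : Fin d → ℝ) {S : Set (Fin d → ℝ)} (hS : MeasurableSet S) :
    (target L b).real S =
      (∫ x in S, Real.exp (psi L b x μ) ∂tilted L b μ) / (tailProb L b).toReal := by
  rw [integral_eq_lintegral_of_nonneg_ae (ae_of_all _ fun _ => (Real.exp_pos _).le)
    (measurable_psi μ).exp.aestronglyMeasurable, ← withDensity_apply _ hS,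
    tilted_withDensity_exp_psi hL hpos, Measure.restrict_apply hS, measureReal_def, target,
    cond_apply (measurableSet_polyhedron L), ENNReal.toReal_mul, ENNReal.toReal_inv,
    Set.inter_comm, tailProb, div_eq_inv_mul]

end MinimaxTilting

/-! ### The constant bound on the likelihood ratio. -/

namespace MinimaxTilting

variable {d : ℕ} {L : Matrix (Fin d) (Fin d) ℝ} {b : Fin d → ℝ}

theorem integral_exp_psi (hL : ∀ i j, i < j → L i j = 0) (hpos : ∀ k, 0 < L k k)
    (μ : Fin d → ℝ) :
    ∫ x, Real.exp (psi L b x μ) ∂tilted L b μ = (tailProb L b).toReal := by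
  rw [integral_eq_lintegral_of_nonneg_ae (ae_of_all _ fun _ => (Real.exp_pos _).le)
    (measurable_psi μ).exp.aestronglyMeasurable, ← setLIntegral_univ, ← withDensity_apply _ .univ,
    tilted_withDensity_exp_psi hL hpos, Measure.restrict_apply_univ, tailProb]

/-- The mean of a positive variable under a probability law is positive; any tilt would serve in
place of 0. -/
theorem tailProb_toReal_pos (hL : ∀ i j, i < j → L i j = 0) (hpos : ∀ k, 0 < L k k) :
    0 < (tailProb L b).toReal := by
  rw [← integral_exp_psi hL hpos 0]
  exact integral_exp_pos (integrable_exp_psi hL hpos 0)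

theorem isProbabilityMeasure_target (hL : ∀ i j, i < j → L i j = 0) (hpos : ∀ k, 0 < L k k) :
    IsProbabilityMeasure (target L b) :=
  cond_isProbabilityMeasure (ENNReal.toReal_pos_iff.1 (tailProb_toReal_pos hL hpos)).1.ne'

/-- The tilting parameter for which `ψ` is bounded by a constant of the order of the logarithm of
the tail probability, when the bound is `L Lᵀ s` with `s > 0`. -/
def dualTilt (L : Matrix (Fin d) (Fin d) ℝ) (s : Fin d → ℝ) : Fin d → ℝ :=
  fun k => (Lᵀ *ᵥ s) k - L k k * s k

/-- An upper bound for `ψ` at the parameter `dualTilt L s`. -/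
noncomputable def psiBound (L : Matrix (Fin d) (Fin d) ℝ) (s : Fin d → ℝ) : ℝ :=
  -((Lᵀ *ᵥ s) ⬝ᵥ (Lᵀ *ᵥ s)) / 2 - ∑ k, Real.log (√(2 * Real.pi) * (L k k * s k))

/-- With `y = Lᵀ s` and slopes `w k = L k k * s k` in `normalTail_le`, the tail terms contribute `y
⬝ᵥ x - w ⬝ᵥ x`, which cancels `-x ⬝ᵥ (y - w)`. What remains is `-(y ⬝ᵥ y) / 2` and the logarithms of
the prefactors. Positivity of `s` makes the slopes admissible. -/
theorem psi_dualTilt_le (hL : ∀ i j, i < j → L i j = 0) (hpos : ∀ k, 0 < L k k)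
    {s : Fin d → ℝ} (hs : ∀ k, 0 < s k) (x : Fin d → ℝ) :
    psi L (L *ᵥ (Lᵀ *ᵥ s)) x (dualTilt L s) ≤ psiBound L s := by
  set y := Lᵀ *ᵥ s with hy
  set u := fun k => lowerBound L (L *ᵥ y) x k - dualTilt L s k with hu
  have hlog : ∀ k, Real.log (normalTail (u k)) ≤
      (L k k * s k) ^ 2 / 2 - L k k * s k * u k - Real.log (√(2 * Real.pi) * (L k k * s k)) := by
    intro k
    have hw : 0 < L k k * s k := mul_pos (hpos k) (hs k)
    have hw' : 0 < √(2 * Real.pi) * (L k k * s k) := by positivity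
    refine (Real.log_le_log (normalTail_pos _) (normalTail_le hw _)).trans_eq ?_
    rw [Real.log_mul (inv_pos.2 hw').ne' (Real.exp_ne_zero _), Real.log_inv, Real.log_exp]
    ring
  have hlb : ∀ k, L k k * s k * lowerBound L (L *ᵥ y) x k =
      s k * (L *ᵥ y) k - s k * (L *ᵥ x) k + L k k * s k * x k := by
    intro k
    have := (hpos k).ne'
    rw [mulVec_eq_sum_Iio hL x k, lowerBound]
    field_simp
    ring
  -- Moving `L` across the pairing with `s` turns both `L y` and `L x` into pairings with `y`.
  have hadj : ∀ z : Fin d → ℝ, ∑ k, s k * (L *ᵥ z) k = ∑ k, y k * z k := by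
    intro z
    have := Matrix.dotProduct_mulVec s L z
    rwa [← Matrix.mulVec_transpose, ← hy] at this
  have hsum : ∑ k, L k k * s k * lowerBound L (L *ᵥ y) x k =
      ∑ k, (y k * y k - y k * x k + L k k * s k * x k) := by
    simp only [hlb, Finset.sum_add_distrib, Finset.sum_sub_distrib, hadj]
  have hbound : psi L (L *ᵥ y) x (dualTilt L s) ≤ -(x ⬝ᵥ dualTilt L s) +
      (dualTilt L s ⬝ᵥ dualTilt L s) / 2 + ∑ k, ((L k k * s k) ^ 2 / 2 - L k k * s k * u k -
        Real.log (√(2 * Real.pi) * (L k k * s k))) := by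
    unfold psi
    gcongr with k
    exact hlog k
  refine hbound.trans_eq ?_
  simp only [hu, mul_sub, Finset.sum_sub_distrib, hsum, psiBound, dotProduct]
  rw [← hy, ← add_sub_assoc]
  congr 1
  rw [← Finset.sum_neg_distrib, ← Finset.sum_neg_distrib, Finset.sum_div, Finset.sum_div,
    ← Finset.sum_sub_distrib, ← Finset.sum_sub_distrib, ← Finset.sum_add_distrib,
    ← Finset.sum_add_distrib]
  refine Finset.sum_congr rfl fun k _ => ?_
  simp only [dualTilt, ← hy]
  ring

theorem exp_psi_le_of_isMinimaxTilt (hL : ∀ i j, i < j → L i j = 0) (hpos : ∀ k, 0 < L k k)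
    {s : Fin d → ℝ} (hs : ∀ k, 0 < s k) {μ : Fin d → ℝ}
    (hμ : IsMinimaxTilt L (L *ᵥ (Lᵀ *ᵥ s)) μ) {x : Fin d → ℝ}
    (hx : x ∈ polyhedron L (L *ᵥ (Lᵀ *ᵥ s))) :
    Real.exp (psi L (L *ᵥ (Lᵀ *ᵥ s)) x μ) ≤ Real.exp (psiBound L s) := by
  refine Real.exp_le_exp.2 (EReal.coe_le_coe_iff.1 ?_)
  calc ((psi L (L *ᵥ (Lᵀ *ᵥ s)) x μ : ℝ) : EReal)
      ≤ ⨆ x ∈ polyhedron L (L *ᵥ (Lᵀ *ᵥ s)), ((psi L (L *ᵥ (Lᵀ *ᵥ s)) x μ : ℝ) : EReal) :=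
        le_iSup₂ (f := fun x _ => ((psi L (L *ᵥ (Lᵀ *ᵥ s)) x μ : ℝ) : EReal)) x hx
    _ ≤ _ := hμ (dualTilt L s)
    _ ≤ _ := iSup₂_le fun x _ => EReal.coe_le_coe_iff.2 (psi_dualTilt_le hL hpos hs x)

/-! ### Exact form and asymptotics of the tail probability. -/

/-- The ratio of the tail probability to its leading order, where `N` is `L⁻¹` with columns
scaled. -/
noncomputable def tailRatio (N : Matrix (Fin d) (Fin d) ℝ) : ℝ :=
  ∫ u in Set.Ici (0 : Fin d → ℝ), Real.exp (-(∑ k, u k) - (N *ᵥ u ⬝ᵥ N *ᵥ u) / 2)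

theorem tailProb_toReal_eq_integral (M : Matrix (Fin d) (Fin d) ℝ) :
    (tailProb M b).toReal = ∫ x, (polyhedron M b).indicator stdDensity x := by
  rw [integral_indicator (measurableSet_polyhedron M), integral_eq_lintegral_of_nonneg_ae
    (ae_of_all _ fun x => (stdDensity_pos x).le) measurable_stdDensity.aestronglyMeasurable,
    tailProb, stdNormal_eq_withDensity, withDensity_apply _ (measurableSet_polyhedron M)]

theorem integral_eq_abs_det_mul_integral_mulVec {N : Matrix (Fin d) (Fin d) ℝ} (hN : N.det ≠ 0)
    {G : (Fin d → ℝ) → ℝ} (hG : Measurable G) :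
    ∫ x, G x = |N.det| * ∫ u, G (N *ᵥ u) := by
  conv_lhs => rw [volume_eq_smul_map_mulVec hN]
  rw [integral_smul_measure, integral_map (measurable_mulVec N).aemeasurable
    hG.aestronglyMeasurable, ENNReal.toReal_ofReal (abs_nonneg _), smul_eq_mul]

/-- Substitute `x = N u + y`, with `y = Lᵀ s` the vertex of the polyhedron. Since `L N` is diagonal
and positive, the polyhedron becomes the orthant; the scaling by `s⁻¹` makes the cross term `y ⬝ᵥ N
u` exactly the sum of the `u k`. The Jacobian and the density at `y` combine to `exp (psiBound L
s)`. -/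
theorem tailProb_toReal_eq (hdet : L.det = ∏ k, L k k) (hpos : ∀ k, 0 < L k k)
    {s : Fin d → ℝ} (hs : ∀ k, 0 < s k) {N : Matrix (Fin d) (Fin d) ℝ}
    (hN : L * N = Matrix.diagonal fun k => (s k)⁻¹) :
    (tailProb L (L *ᵥ (Lᵀ *ᵥ s))).toReal = Real.exp (psiBound L s) * tailRatio N := by
  set y := Lᵀ *ᵥ s with hy
  have hdetN : N.det = ∏ k, (L k k * s k)⁻¹ := by
    have h := congrArg Matrix.det hN
    rw [Matrix.det_mul, Matrix.det_diagonal, hdet] at h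
    have hne : ∏ k, L k k ≠ 0 := Finset.prod_ne_zero_iff.2 fun k _ => (hpos k).ne'
    refine mul_left_cancel₀ hne (h.trans ?_)
    rw [← Finset.prod_mul_distrib]
    refine Finset.prod_congr rfl fun k _ => ?_
    have := (hpos k).ne'
    field_simp
  have hdetpos : 0 < N.det := by
    rw [hdetN]
    exact Finset.prod_pos fun k _ => inv_pos.2 (mul_pos (hpos k) (hs k))
  have hrow : ∀ u k, (L *ᵥ (N *ᵥ u)) k = (s k)⁻¹ * u k := by
    intro u k
    rw [Matrix.mulVec_mulVec, hN, Matrix.mulVec_diagonal]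
  have hmem : ∀ u, N *ᵥ u + y ∈ polyhedron L (L *ᵥ y) ↔ u ∈ Set.Ici (0 : Fin d → ℝ) := by
    intro u
    simp only [polyhedron, Set.mem_ofPred_eq, Matrix.mulVec_add, Pi.add_apply, hrow,
      le_add_iff_nonneg_left, Set.mem_Ici, Pi.le_def, Pi.zero_apply]
    refine forall_congr' fun k => ?_
    rw [mul_nonneg_iff_of_pos_left (inv_pos.2 (hs k))]
  have hcross : ∀ u, y ⬝ᵥ N *ᵥ u = ∑ k, u k := by
    intro u
    rw [hy, Matrix.mulVec_transpose, ← Matrix.dotProduct_mulVec, dotProduct]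
    refine Finset.sum_congr rfl fun k _ => ?_
    rw [hrow, mul_inv_cancel_left₀ (hs k).ne']
  have hden : ∀ u, stdDensity (N *ᵥ u + y) = (√(2 * Real.pi))⁻¹ ^ d * Real.exp (-(y ⬝ᵥ y) / 2) *
      Real.exp (-(∑ k, u k) - (N *ᵥ u ⬝ᵥ N *ᵥ u) / 2) := by
    intro u
    rw [stdDensity_eq, mul_assoc, ← Real.exp_add, add_dotProduct, dotProduct_add, dotProduct_add,
      dotProduct_comm (N *ᵥ u) y, hcross]
    congr 2
    ring
  have hexp : Real.exp (psiBound L s) =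
      N.det * ((√(2 * Real.pi))⁻¹ ^ d * Real.exp (-(y ⬝ᵥ y) / 2)) := by
    rw [psiBound, ← hy, sub_eq_add_neg, Real.exp_add, Real.exp_neg (∑ k, _), Real.exp_sum, hdetN]
    have : ∀ k, Real.exp (Real.log (√(2 * Real.pi) * (L k k * s k))) =
        √(2 * Real.pi) * (L k k * s k) := fun k =>
      Real.exp_log (mul_pos (by positivity) (mul_pos (hpos k) (hs k)))
    simp only [this, Finset.prod_mul_distrib, Finset.prod_const, Finset.card_univ,
      Fintype.card_fin, Finset.prod_inv_distrib, mul_inv, inv_pow]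
    ring
  rw [tailProb_toReal_eq_integral, ← integral_add_right_eq_self _ y,
    integral_eq_abs_det_mul_integral_mulVec hdetpos.ne'
      (G := fun x => (polyhedron L (L *ᵥ y)).indicator stdDensity (x + y))
      ((measurable_stdDensity.indicator (measurableSet_polyhedron L)).comp
        (measurable_add_const y)), abs_of_pos hdetpos, hexp, mul_assoc, tailRatio,
    ← integral_indicator measurableSet_Ici, ← integral_const_mul (_ * _)]
  refine congrArg (N.det * ·) (integral_congr_ae (ae_of_all _ fun u => ?_))
  beta_reduce
  by_cases hu : u ∈ Set.Ici (0 : Fin d → ℝ)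
  · rw [Set.indicator_of_mem hu, Set.indicator_of_mem ((hmem u).2 hu), hden]
  · rw [Set.indicator_of_notMem hu, Set.indicator_of_notMem (mt (hmem u).1 hu), mul_zero]

theorem restrict_Ici_zero_eq_pi :
    (volume : Measure (Fin d → ℝ)).restrict (Set.Ici 0) =
      Measure.pi fun _ => (volume : Measure ℝ).restrict (Set.Ici 0) := by
  rw [← Set.pi_univ_Ici, volume_pi, Measure.restrict_pi_pi]
  rfl

/-- The quadratic term carries `γ⁻²` and vanishes pointwise; dropping it gives the dominating
function, a product of unit exponential densities. -/
theorem tendsto_tailRatio_inv_smul (N : Matrix (Fin d) (Fin d) ℝ) :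
    Tendsto (fun γ : ℝ => tailRatio (γ⁻¹ • N)) atTop (𝓝 1) := by
  have hprod : ∀ u : Fin d → ℝ, Real.exp (-∑ k, u k) = ∏ k, Real.exp (-u k) := fun u => by
    rw [← Finset.sum_neg_distrib, Real.exp_sum]
  have hone : ∫ u in Set.Ici (0 : Fin d → ℝ), Real.exp (-∑ k, u k) = 1 := by
    simp_rw [hprod, restrict_Ici_zero_eq_pi]
    rw [integral_fintype_prod_eq_prod (𝕜 := ℝ) (fun _ : Fin d => fun t : ℝ => Real.exp (-t))]
    simp only [integral_Ici_eq_integral_Ioi, integral_exp_neg_Ioi_zero, Finset.prod_const_one]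
  have hint : IntegrableOn (fun u : Fin d → ℝ => Real.exp (-∑ k, u k)) (Set.Ici 0) := by
    rw [IntegrableOn, restrict_Ici_zero_eq_pi]
    simp_rw [hprod]
    refine Integrable.fintype_prod (𝕜 := ℝ) (f := fun _ : Fin d => fun t : ℝ => Real.exp (-t))
      fun _ => ?_
    have := (integrableOn_Ici_iff_integrableOn_Ioi (by simp)).2
      (integrableOn_exp_mul_Ioi (a := -1) (by norm_num) 0)
    simpa [IntegrableOn] using this
  rw [← hone]
  refine tendsto_integral_filter_of_dominated_convergence
    (fun u => Real.exp (-∑ k, u k)) ?_ ?_ hint ?_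
  · refine Eventually.of_forall fun γ => Measurable.aestronglyMeasurable ?_
    have := measurable_mulVec (γ⁻¹ • N)
    unfold dotProduct
    fun_prop
  · refine Eventually.of_forall fun γ => ae_of_all _ fun u => ?_
    rw [Real.norm_of_nonneg (Real.exp_pos _).le]
    refine Real.exp_le_exp.2 (sub_le_self _ (div_nonneg ?_ zero_le_two))
    exact Finset.sum_nonneg fun k _ => mul_self_nonneg _
  · refine ae_of_all _ fun u => ?_
    have h0 : Tendsto (fun γ : ℝ => -(∑ k, u k) - γ⁻¹ * (γ⁻¹ * (N *ᵥ u ⬝ᵥ N *ᵥ u)) / 2) atTop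
        (𝓝 (-(∑ k, u k) - 0 * (0 * (N *ᵥ u ⬝ᵥ N *ᵥ u)) / 2)) :=
      tendsto_const_nhds.sub ((tendsto_inv_atTop_zero.mul
        (tendsto_inv_atTop_zero.mul_const _)).div_const 2)
    simp only [zero_mul, zero_div, sub_zero] at h0
    simpa only [Function.comp_def, Matrix.smul_mulVec, smul_dotProduct, dotProduct_smul, smul_eq_mul] using
      (Real.continuous_exp.tendsto _).comp h0

/-! ### The two asymptotic regimes. -/

theorem tendsto_tvDist_of_hasVanishingRelativeError {A Q : Matrix (Fin d) (Fin d) ℝ}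
    (hA : A.rank = d) (hLQ : IsLQ A L Q) {l : Fin d → ℝ} {μ : ℝ → Fin d → ℝ}
    (h : HasVanishingRelativeError A L l μ) :
    Tendsto (fun γ : ℝ => tvDist (target A (γ • l)) (instrumental L Q (γ • l) (μ γ)))
      atTop (𝓝 0) := by
  have hpos := hLQ.diag_pos hA
  have hlim := tendsto_of_le_liminf_of_limsup_le bot_le h.le
  have hsqrt := ((ENNReal.tendsto_toReal ENNReal.zero_ne_top).comp hlim).sqrt
  rw [ENNReal.toReal_zero, Real.sqrt_zero] at hsqrt
  refine squeeze_zero' (Eventually.of_forall fun γ => tvDist_nonneg _ _) ?_ hsqrt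
  -- An eventually finite ratio puts `exp ψ` in L². Without this, the real variance could be the
  -- default 0 of an infinite extended variance and bound nothing.
  filter_upwards [hlim.eventually_lt_const ENNReal.zero_lt_top] with γ hγ
  rw [hLQ.tailProb_eq] at hγ
  have htail := tailProb_toReal_pos hLQ.lower hpos (b := γ • l)
  have := isProbabilityMeasure_target hLQ.lower hpos (b := γ • l)
  have hmem : MemLp (fun x => Real.exp (psi L (γ • l) x (μ γ))) 2 (tilted L (γ • l) (μ γ)) := by
    rw [← evariance_lt_top_iff_memLp (measurable_psi (μ γ)).exp.aestronglyMeasurable]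
    refine lt_top_iff_ne_top.2 fun htop => hγ.ne ?_
    rw [htop, ENNReal.top_div_of_ne_top]
    exact ENNReal.pow_ne_top (ENNReal.toReal_pos_iff.1 htail).2.ne
  rw [hLQ.target_eq_map, instrumental]
  refine tvDist_map_le (measurable_mulVec Q) fun S hS => ?_
  refine (abs_measureReal_sub_le_sqrt_variance hmem htail
    (fun S hS => target_real_eq hLQ.lower hpos (μ γ) hS) hS).trans_eq ?_
  simp only [Function.comp_apply, hLQ.tailProb_eq, ENNReal.toReal_div, ENNReal.toReal_pow, variance]

theorem tendsto_tvDist_of_dual_pos {A Q : Matrix (Fin d) (Fin d) ℝ}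
    (hA : A.rank = d) (hLQ : IsLQ A L Q) {l : Fin d → ℝ} {μ : ℝ → Fin d → ℝ}
    (hμ : ∀ γ : ℝ, 0 < γ → IsMinimaxTilt L (γ • l) (μ γ)) {s : Fin d → ℝ} (hs : ∀ k, 0 < s k)
    (hl : l = (A * Aᵀ) *ᵥ s) :
    Tendsto (fun γ : ℝ => tvDist (target A (γ • l)) (instrumental L Q (γ • l) (μ γ)))
      atTop (𝓝 0) := by
  have hpos := hLQ.diag_pos hA
  have hl' : ∀ γ : ℝ, γ • l = L *ᵥ (Lᵀ *ᵥ (γ • s)) := by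
    intro γ
    have hQ := (Matrix.mem_orthogonalGroup_iff' (Fin d) ℝ).1 hLQ.orthogonal
    have hAA : A * Aᵀ = L * Lᵀ := by
      rw [hLQ.eq_mul, Matrix.transpose_mul, Matrix.transpose_transpose, Matrix.mul_assoc,
        ← Matrix.mul_assoc Qᵀ, show Qᵀ * Q = 1 from hQ, Matrix.one_mul]
    rw [hl, hAA, ← Matrix.mulVec_mulVec, Matrix.mulVec_smul, Matrix.mulVec_smul]
  -- Replacing `s` by `γ • s` replaces this `N` by `γ⁻¹ • N`, so one fixed matrix serves all `γ`.
  set N := L⁻¹ * Matrix.diagonal fun k => (s k)⁻¹ with hN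
  have hlim := (tendsto_tailRatio_inv_smul N).inv₀ one_ne_zero |>.sub_const 1
  rw [inv_one, sub_self] at hlim
  refine squeeze_zero' (Eventually.of_forall fun γ => tvDist_nonneg _ _) ?_ hlim
  filter_upwards [eventually_gt_atTop 0] with γ hγ
  have hsγ : ∀ k, 0 < (γ • s) k := fun k => mul_pos hγ (hs k)
  have hLN : L * (γ⁻¹ • N) = Matrix.diagonal fun k => ((γ • s) k)⁻¹ := by
    rw [Matrix.mul_smul, hN, ← Matrix.mul_assoc, Matrix.mul_nonsing_inv L
      (hLQ.det_ne_zero hA).isUnit, Matrix.one_mul, ← Matrix.diagonal_smul]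
    congr 1
    ext k
    simp [mul_comm]
  have htail := tailProb_toReal_pos hLQ.lower hpos (b := γ • l)
  have := isProbabilityMeasure_target hLQ.lower hpos (b := γ • l)
  have heq := tailProb_toReal_eq hLQ.det_eq_prod hpos hsγ hLN
  have hmini := hμ γ hγ
  rw [hLQ.target_eq_map, instrumental]
  rw [hl'] at htail this hmini ⊢
  refine tvDist_map_le (measurable_mulVec Q) fun S hS => ?_
  refine (abs_measureReal_sub_le_of_ae_le (integrable_exp_psi hLQ.lower hpos (μ γ)) htail
    (fun S hS => target_real_eq hLQ.lower hpos (μ γ) hS)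
    ((ae_mem_polyhedron hLQ.lower hpos (μ γ)).mono fun x hx =>
      exp_psi_le_of_isMinimaxTilt hLQ.lower hpos hsγ hmini hx) hS).trans_eq ?_
  -- The bound on `exp ψ` is also the leading factor of `ℓ`, so only the inverse tail ratio
  -- survives.
  rw [heq, div_mul_cancel_left₀ (Real.exp_ne_zero _)]

end MinimaxTilting

theorem corollary1 {d : ℕ} (A L Q : Matrix (Fin d) (Fin d) ℝ) (hA : A.rank = d)
    (hLQ : MinimaxTilting.IsLQ A L Q) (l : Fin d → ℝ) (μ : ℝ → Fin d → ℝ)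
    (hμ : ∀ γ : ℝ, 0 < γ → MinimaxTilting.IsMinimaxTilt L (γ • l) (μ γ))
    (h : ((∀ k, 0 < l k) ∧ MinimaxTilting.HasVanishingRelativeError A L l μ) ∨
      ∃ lstar : Fin d → ℝ, (∀ k, 0 < lstar k) ∧ l = (A * Aᵀ) *ᵥ lstar) :
    Tendsto (fun γ : ℝ => MinimaxTilting.tvDist (MinimaxTilting.target A (γ • l))
      (MinimaxTilting.instrumental L Q (γ • l) (μ γ))) atTop (𝓝 0) := by
  rcases h with ⟨_, h⟩ | ⟨s, hs, hl⟩
  · exact MinimaxTilting.tendsto_tvDist_of_hasVanishingRelativeError hA hLQ h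
  · exact MinimaxTilting.tendsto_tvDist_of_dual_pos hA hLQ hμ hs hl
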